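/- \textbf{Theorem (upper semi-continuous dynamic programming).} Let $S$ be a complete separable metric space with its Borel $\sigma$-algebra, let $A\subseteq\mathbb R^k$ be a Borel set, and let $\Gamma$ assign to each $s\in S$ a Borel set $\Gamma(s)\subseteq A$ of feasible actions. Let $p(s,a,\cdot)$ be a Borel transition probability from $S\times A$ to $S$, let $r:S\times A\to\mathbb R$ be Borel measurable, and let $0<\beta<1$. A strategy $\sigma=(\sigma_1,\sigma_2,\dots)$ consists of Borel measurable maps $\sigma_t:S\times(A\times S)^{t-1}\to A$ with $\sigma_t(s(1),a(1),\dots,s(t))\in\Gamma(s(t))$ for all histories. Given $s(1)=s$, it induces a law of $(s(t),a(t))_{t\ge1}$ under which $a(t)=\sigma_t(s(1),a(1),\dots,s(t))$ and $s(t+1)$ has conditional law $p(s(t),a(t),\cdot)$ given the history up to time $t$. Put $$V_\sigma(s)=\mathbb E_\sigma\sum_{t=1}^\infty\beta^{t-1}r(s(t),a(t)),\qquad V(s)=\sup_\sigma V_\sigma(s).$$ The strategy $\sigma$ is optimal if $V_\sigma(s)=V(s)$ for all $s\in S$. A stationary policy is a measurable $\lambda:S\to A$ with $\lambda(s)\in\Gamma(s)$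 for all $s$; it is identified with the strategy $\sigma_t(s(1),a(1),\dots,s(t))=\lambda(s(t))$. A real function $f$ on a metric space is upper semi-continuous (u.s.c.) if $\{f<\alpha\}$ is open for every $\alpha\in\mathbb R$. The kernel $p$ is u.s.c. if $(s,a)\mapsto\int_S f(s')\,p(s,a,ds')$ is bounded and u.s.c. whenever $f:S\to\mathbb R$ is bounded and u.s.c. The correspondence $\Gamma$ is u.s.c. if $\{s\in S:\Gamma(s)\subseteq U\}$ is open for every open $U\subseteq A$. Suppose that $r$ is bounded and u.s.c., that $p$ is u.s.c., and that $\Gamma$ is u.s.c. with $\Gamma(s)$ non-empty and compact for each $s\in S$. Then the sums and expectations defining $V_\sigma(s)$ exist and $V(s)$ is a finite supremum over a non-empty set of strategies; $V$ is the unique bounded u.s.c. function $f:S\to\mathbb R$ that satisfies the Bellman equation $$f(s)=\sup_{a\in\Gamma(s)}\Big\{r(s,a)+\beta\int_S f(s')\,p(s,a,ds')\Big\}\qquad(s\in S);$$ and there is a Borel measurable stationary policy that is optimal. -/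

import Mathlib

open MeasureTheory ProbabilityTheory

noncomputable section

/-- A discounted dynamic programming model with infinite horizon: states `S`, actions `A`,
feasibility correspondence `Γ`, transition probability `p`, payoff `r`, discount factor `β`. -/
structure DiscountedDP (S A : Type*) [MeasurableSpace S] [MeasurableSpace A] where
  Γ : S → Set A
  measurableSet_Γ : ∀ s, MeasurableSet (Γ s)
  p : Kernel (S × A) S
  isMarkovKernel_p : IsMarkovKernel p
  r : S × A → ℝ
  measurable_r : Measurable r
  β : ℝ
  β_pos : 0 < β
  β_lt_one : β < 1

namespace DiscountedDP

/-- A real function is bounded and upper semi-continuous. -/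
def IsBddUSC {X : Type*} [TopologicalSpace X] (f : X → ℝ) : Prop :=
  (∃ C : ℝ, ∀ x, |f x| ≤ C) ∧ UpperSemicontinuous f

/-- A transition kernel is upper semi-continuous if it maps bounded u.s.c. functions to bounded
u.s.c. functions. -/
def KernelUSC {X Y : Type*} [TopologicalSpace X] [MeasurableSpace X]
    [TopologicalSpace Y] [MeasurableSpace Y] (κ : Kernel X Y) : Prop :=
  ∀ f : Y → ℝ, IsBddUSC f → IsBddUSC (fun x => ∫ y, f y ∂(κ x))

/-- Histories `(s 0, a 0, …, s (n - 1), a (n - 1), s n)` up to (and including) the state at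
time `n`; time starts at `0`. -/
abbrev History (S A : Type*) (n : ℕ) : Type _ := (Fin n → S × A) × S

variable {S A : Type*} [MeasurableSpace S] [MeasurableSpace A] (M : DiscountedDP S A)

instance : IsMarkovKernel M.p := M.isMarkovKernel_p

/-- A strategy: measurable, history dependent, always feasible choices of actions. -/
structure Strategy where
  act : ∀ n : ℕ, History S A n → A
  measurable_act : ∀ n, Measurable (act n)
  feasible : ∀ n (h : History S A n), act n h ∈ M.Γ h.2

variable {M}

/-- The strategy that plays `l (s n)` at every history `(s 0, a 0, …, s n)`. -/
def Strategy.stationary (l : S → A) (hl : Measurable l) (hf : ∀ s, l s ∈ M.Γ s) :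
    M.Strategy where
  act _ h := l h.2
  measurable_act _ := hl.comp measurable_snd
  feasible _ h := hf h.2

/-- The pair (next state `s'`, action at time `n + 1`) after the state-action pairs `h` of the
times `0, …, n`. -/
def Strategy.nextPair (σ : M.Strategy) (n : ℕ)
    (x : (Finset.Iic n → S × A) × S) : S × A :=
  (x.2, σ.act (n + 1)
    (fun i : Fin (n + 1) => x.1 ⟨i, Finset.mem_Iic.2 (Nat.lt_succ_iff.1 i.2)⟩, x.2))

lemma Strategy.measurable_nextPair (σ : M.Strategy) (n : ℕ) : Measurable (σ.nextPair n) := by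
  refine measurable_snd.prodMk ((σ.measurable_act (n + 1)).comp ?_)
  refine Measurable.prodMk ?_ measurable_snd
  exact measurable_pi_lambda _ fun i => (measurable_pi_apply _).comp measurable_fst

/-- The conditional law of the state-action pair at time `n + 1` given the pairs of the times
`0, …, n`: the state is drawn from `p (s n, a n)`, then the strategy chooses the action. -/
def Strategy.step (σ : M.Strategy) (n : ℕ) : Kernel (Finset.Iic n → S × A) (S × A) :=
  (Kernel.id ×ₖ M.p.comap (fun h : Finset.Iic n → S × A => h ⟨n, Finset.mem_Iic.2 le_rfl⟩)
    (measurable_pi_apply _)).map (σ.nextPair n)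

instance (σ : M.Strategy) (n : ℕ) : IsMarkovKernel (σ.step n) :=
  Kernel.IsMarkovKernel.map _ (σ.measurable_nextPair n)

lemma Strategy.step_apply (σ : M.Strategy) (n : ℕ) (h : Finset.Iic n → S × A) :
    σ.step n h =
      (M.p (h ⟨n, Finset.mem_Iic.2 le_rfl⟩)).map (fun s' => σ.nextPair n (h, s')) := by
  rw [Strategy.step, Kernel.map_apply _ (σ.measurable_nextPair n), Kernel.prod_apply,
    Kernel.id_apply, Kernel.comap_apply, Measure.dirac_prod,
    Measure.map_map (σ.measurable_nextPair n) measurable_prodMk_left]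
  rfl

/-- The law on infinite histories `(s t, a t)_{t ≥ 0}` induced by the strategy, the transition
probability and the initial state (by the Ionescu-Tulcea theorem). -/
def Strategy.law (σ : M.Strategy) (s : S) : Measure (ℕ → S × A) :=
  Kernel.trajMeasure (X := fun _ => S × A)
    (Measure.dirac (s, σ.act 0 (Fin.elim0, s))) (fun n => σ.step n)

variable (M)

/-- The discounted payoff along an infinite history. -/
def discountedPayoff (ω : ℕ → S × A) : ℝ := ∑' t : ℕ, M.β ^ t * M.r (ω t)

/-- The expected discounted payoff `V_σ`. -/
def expectedPayoff (σ : M.Strategy) (s : S) : ℝ := ∫ ω, M.discountedPayoff ω ∂(σ.law s)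

/-- The value function `V`. -/
def value (s : S) : ℝ := ⨆ σ : M.Strategy, M.expectedPayoff σ s

/-- A strategy is optimal if it attains the value from every initial state. -/
def IsOptimal (σ : M.Strategy) : Prop := ∀ s, M.expectedPayoff σ s = M.value s

/-- `Q (s, a, f)`, the payoff of `a` at `s` now and of `f` at the next period. -/
def Q (s : S) (a : A) (f : S → ℝ) : ℝ := M.r (s, a) + M.β * ∫ s', f s' ∂(M.p (s, a))

/-- The Bellman operator. -/
def bellman (f : S → ℝ) (s : S) : ℝ := ⨆ a : M.Γ s, M.Q s a f

end DiscountedDP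

end

/-! The Bellman operator preserves bounded u.s.c. functions: upper semicontinuity of `r` and `p`
makes `Q` u.s.c. in the pair (s, a), and Berge's theorem keeps this under the maximum over the
compact sets Γ(s). It contracts the supremum norm by β, so its iterates from 0 converge uniformly to
a bounded u.s.c. fixed point (`exists_bellman_fixedPoint`).

Every such fixed point f is the value. Along any strategy Q ≤ f almost surely; taking expectations,
discounting and summing, the f-terms telescope and leave V_σ ≤ f (`expectedPayoff_le`). A measurable
choice of maximizers (`exists_measurable_argmax`) turns Q ≤ f into an equality, so the corresponding
stationary policy earns exactly f. This gives optimality, and also uniqueness, since it applies to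
every bounded u.s.c. solution. -/

open MeasureTheory ProbabilityTheory Filter Topology Set

/-! ### Maxima of u.s.c. functions over u.s.c. correspondences -/

section Topology

variable {S A : Type*} [TopologicalSpace S] [TopologicalSpace A] {Γ : S → Set A} {q : S × A → ℝ}

/-- For a u.s.c. compact-valued correspondence and a u.s.c. function, the set of points where
the function is at least `c` somewhere on the trace of a closed set is closed. -/
lemma UpperHemicontinuous.isClosed_setOf_exists_le (hΓ : UpperHemicontinuous Γ)
    (hΓc : ∀ s, IsCompact (Γ s)) (hq : UpperSemicontinuous q) {F : Set A} (hF : IsClosed F)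
    (c : ℝ) : IsClosed {s | ∃ a ∈ Γ s ∩ F, c ≤ q (s, a)} := by
  rw [← isOpen_compl_iff, isOpen_iff_mem_nhds]
  intro s hs
  have hs' : ∀ a ∈ Γ s, a ∈ F → q (s, a) < c := by
    intro a ha haF
    by_contra! h
    exact hs ⟨a, ⟨ha, haF⟩, h⟩
  -- The tube lemma needs an open set containing {s} × Γ(s): either the action misses F, or q is
  -- below c.
  have hopen : IsOpen (Prod.snd ⁻¹' Fᶜ ∪ q ⁻¹' Iio c : Set (S × A)) :=
    (hF.isOpen_compl.preimage continuous_snd).union (hq.isOpen_preimage c)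
  obtain ⟨u, v, hu, hv, hsu, htv, huv⟩ := generalized_tube_lemma (isCompact_singleton (x := s))
    (hΓc s) hopen (by
      rintro ⟨s', a⟩ ⟨rfl, ha⟩
      by_cases h : a ∈ F
      · exact Or.inr (hs' a ha h)
      · exact Or.inl h)
  filter_upwards [hu.mem_nhds (hsu rfl), hΓ s v (hv.mem_nhdsSet.2 htv)] with s' h1 h2
  rintro ⟨a, ⟨ha, haF⟩, hc⟩
  rcases huv (mk_mem_prod h1 (subset_of_mem_nhdsSet h2 ha)) with h | h
  · exact h haF
  · exact absurd hc (not_le.2 h)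

lemma UpperSemicontinuous.section_right (hq : UpperSemicontinuous q) (s : S) :
    UpperSemicontinuous fun a => q (s, a) :=
  hq.comp (Continuous.prodMk_right s)

lemma UpperSemicontinuous.exists_isGreatest_image (hq : UpperSemicontinuous q)
    (hΓc : ∀ s, IsCompact (Γ s)) (hΓn : ∀ s, (Γ s).Nonempty) (s : S) :
    ∃ a ∈ Γ s, (∀ b ∈ Γ s, q (s, b) ≤ q (s, a)) ∧ ⨆ b : Γ s, q (s, b) = q (s, a) := by
  obtain ⟨a, ha, hmax⟩ := ((hq.section_right s).upperSemicontinuousOn (Γ s)).exists_isMaxOn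
    (hΓn s) (hΓc s)
  refine ⟨a, ha, fun b hb => hmax hb, le_antisymm ?_ ?_⟩
  · have : Nonempty (Γ s) := ⟨a, ha⟩
    exact ciSup_le fun b => hmax b.2
  · exact le_ciSup (f := fun b : Γ s => q (s, b))
      ⟨q (s, a), by rintro _ ⟨b, rfl⟩; exact hmax b.2⟩ ⟨a, ha⟩

/-- Berge's maximum theorem, u.s.c. part. -/
lemma UpperHemicontinuous.upperSemicontinuous_iSup (hΓ : UpperHemicontinuous Γ)
    (hΓc : ∀ s, IsCompact (Γ s)) (hΓn : ∀ s, (Γ s).Nonempty) (hq : UpperSemicontinuous q) :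
    UpperSemicontinuous fun s => ⨆ a : Γ s, q (s, a) := by
  rw [upperSemicontinuous_iff_isClosed_preimage]
  intro c
  convert hΓ.isClosed_setOf_exists_le hΓc hq isClosed_univ c using 1
  ext s
  obtain ⟨a, ha, hmax, heq⟩ := hq.exists_isGreatest_image hΓc hΓn s
  simp only [mem_preimage, mem_Ici, heq, inter_univ, mem_ofPred_eq]
  exact ⟨fun h => ⟨a, ha, h⟩, fun ⟨b, hb, h⟩ => h.trans (hmax b hb)⟩

end Topology

/-! ### Measurable selection of maximizers -/

section Selection

variable {S A : Type*}

/-- The maximizers of `q (s, ·)` over `D s`. -/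
def argmaxOn (D : S → Set A) (q : S × A → ℝ) (s : S) : Set A :=
  {a ∈ D s | ∀ b ∈ D s, q (s, b) ≤ q (s, a)}

variable {D : S → Set A} {q : S × A → ℝ} {s : S}

lemma argmaxOn_subset : argmaxOn D q s ⊆ D s := fun _ h => h.1

variable [TopologicalSpace A]

lemma nonempty_argmaxOn (hq : UpperSemicontinuous fun a => q (s, a)) (hc : IsCompact (D s))
    (hn : (D s).Nonempty) : (argmaxOn D q s).Nonempty := by
  obtain ⟨a, ha, hmax⟩ := (hq.upperSemicontinuousOn (D s)).exists_isMaxOn hn hc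
  exact ⟨a, ha, fun b hb => hmax hb⟩

lemma isCompact_argmaxOn (hq : UpperSemicontinuous fun a => q (s, a)) (hc : IsCompact (D s)) :
    IsCompact (argmaxOn D q s) := by
  rcases (argmaxOn D q s).eq_empty_or_nonempty with h | ⟨a, ha, hmax⟩
  · simp [h]
  convert (hq.upperSemicontinuousOn (D s)).isCompact_inter_preimage_Ici hc (q (s, a)) using 1
  ext b
  exact ⟨fun h => ⟨h.1, h.2 a ha⟩, fun h => ⟨h.1, fun d hd => (hmax d hd).trans h.2⟩⟩

/-- A maximizer lies in F exactly when every level reached on D(s) is reached on D(s) ∩ F. Rational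
levels suffice, which leaves a countable intersection. -/
lemma measurableSet_argmaxOn_inter_nonempty [MeasurableSpace S]
    (hq : ∀ s, UpperSemicontinuous fun a => q (s, a)) (hc : ∀ s, IsCompact (D s))
    (hn : ∀ s, (D s).Nonempty)
    (hm : ∀ F : Set A, IsClosed F → ∀ c : ℝ, MeasurableSet {s | ∃ a ∈ D s ∩ F, c ≤ q (s, a)})
    {F : Set A} (hF : IsClosed F) : MeasurableSet {s | (argmaxOn D q s ∩ F).Nonempty} := by
  have key : {s | (argmaxOn D q s ∩ F).Nonempty} =
      ⋂ c : ℚ, ({s | ∃ a ∈ D s ∩ univ, (c : ℝ) ≤ q (s, a)}ᶜ ∪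
        {s | ∃ a ∈ D s ∩ F, (c : ℝ) ≤ q (s, a)}) := by
    ext s
    simp only [mem_ofPred_eq, mem_iInter, mem_union, mem_compl_iff, ← imp_iff_not_or, inter_univ]
    constructor
    · rintro ⟨a, ⟨ha, hmax⟩, haF⟩ c ⟨b, hb, hcb⟩
      exact ⟨a, ⟨ha, haF⟩, hcb.trans (hmax b hb)⟩
    · intro h
      obtain ⟨a, ha, hmax⟩ := nonempty_argmaxOn (hq s) (hc s) (hn s)
      -- A level below the maximum serves only to show that D(s) ∩ F is nonempty.
      obtain ⟨c₀, hc₀⟩ := exists_rat_lt (q (s, a))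
      obtain ⟨b₀, hb₀, -⟩ := h c₀ ⟨a, ha, hc₀.le⟩
      obtain ⟨b, hb, hbmax⟩ := ((hq s).upperSemicontinuousOn (D s ∩ F)).exists_isMaxOn
        ⟨b₀, hb₀⟩ ((hc s).inter_right hF)
      refine ⟨b, ⟨hb.1, fun d hd => (hmax d hd).trans ?_⟩, hb.2⟩
      by_contra! hlt
      obtain ⟨c, hc1, hc2⟩ := exists_rat_btwn hlt
      obtain ⟨d, hd, hcd⟩ := h c ⟨a, ha, hc2.le⟩
      exact absurd (hbmax hd) (not_le.2 (hc1.trans_le hcd))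
  rw [key]
  exact MeasurableSet.iInter fun c => (hm _ isClosed_univ _).compl.union (hm _ hF _)

/-- A measurable selection theorem for compact-valued correspondences. -/
theorem exists_measurable_selection {S A : Type*} [MeasurableSpace S] [MetricSpace A]
    [TopologicalSpace.SeparableSpace A] [MeasurableSpace A] [BorelSpace A] {D : S → Set A}
    (hc : ∀ s, IsCompact (D s)) (hn : ∀ s, (D s).Nonempty)
    (hm : ∀ F : Set A, IsClosed F → MeasurableSet {s | (D s ∩ F).Nonempty}) :
    ∃ l : S → A, Measurable l ∧ ∀ s, l s ∈ D s := by
  rcases isEmpty_or_nonempty S with hS | ⟨⟨s₀⟩⟩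
  · exact ⟨fun s => hS.elim s, measurable_of_empty _, fun s => hS.elim s⟩
  have : Nonempty A := (hn s₀).to_type
  let x := TopologicalSpace.denseSeq A
  let φ : ℕ → S × A → ℝ := fun n y => -dist y.2 (x n)
  have hφ : ∀ n (s : S), UpperSemicontinuous fun a => φ n (s, a) := fun n s =>
    Continuous.upperSemicontinuous (f := fun a => -dist a (x n)) (by fun_prop)
  -- Starting from D, each stage keeps the points nearest to the next term of a dense sequence; the
  -- sets shrink to a single point.
  let E : ℕ → S → Set A := fun n => Nat.rec D (fun n D' => argmaxOn D' (φ n)) n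
  have hE : ∀ n, (∀ s, IsCompact (E n s)) ∧ (∀ s, (E n s).Nonempty) ∧
      ∀ F : Set A, IsClosed F → MeasurableSet {s | (E n s ∩ F).Nonempty} := by
    intro n
    induction n with
    | zero => exact ⟨hc, hn, hm⟩
    | succ n ih =>
      obtain ⟨h1, h2, h3⟩ := ih
      refine ⟨fun s => isCompact_argmaxOn (hφ n s) (h1 s),
        fun s => nonempty_argmaxOn (hφ n s) (h1 s) (h2 s), fun F hF =>
        measurableSet_argmaxOn_inter_nonempty (hφ n) h1 h2 (fun G hG c => ?_) hF⟩
      -- The superlevel sets of φ n do not depend on s, so they are absorbed into the closed test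
      -- set of the induction hypothesis.
      have hcl : IsClosed (G ∩ {a | c ≤ -dist a (x n)}) :=
        hG.inter (isClosed_le continuous_const (by fun_prop))
      convert h3 _ hcl using 1
      ext s
      simp only [φ, mem_ofPred_eq, Set.Nonempty, mem_inter_iff, and_assoc]
  have hcantor : ∀ (F : Set A), IsClosed F → ∀ s, (∀ n, (E n s ∩ F).Nonempty) →
      (⋂ n, E n s ∩ F).Nonempty := fun F hF s h =>
    IsCompact.nonempty_iInter_of_sequence_nonempty_isCompact_isClosed _
      (fun n => inter_subset_inter_left _ argmaxOn_subset) h (((hE 0).1 s).inter_right hF)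
      fun n => ((hE n).1 s).isClosed.inter hF
  -- Points that survive every stage have equal distances to a dense set, hence to all points, in
  -- particular to b.
  have huniq : ∀ s a b, (∀ n, a ∈ E n s) → (∀ n, b ∈ E n s) → a = b := by
    intro s a b ha hb
    have hd : ∀ n, dist a (x n) = dist b (x n) := by
      intro n
      have h1 := (ha (n + 1)).2 b (hb n)
      have h2 := (hb (n + 1)).2 a (ha n)
      simp only [φ] at h1 h2
      linarith
    have hfun : (fun y => dist a y) = fun y => dist b y :=
      Continuous.ext_on (TopologicalSpace.denseRange_denseSeq A) (by fun_prop) (by fun_prop)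
        (by rintro _ ⟨n, rfl⟩; exact hd n)
    have := congrFun hfun b
    simpa using this
  have hsel : ∀ s, ∃ a, ∀ n, a ∈ E n s := by
    intro s
    obtain ⟨a, ha⟩ := hcantor univ isClosed_univ s fun n => by simpa using (hE n).2.1 s
    exact ⟨a, fun n => (mem_iInter.1 ha n).1⟩
  choose l hl using hsel
  refine ⟨l, measurable_of_isClosed fun F hF => ?_, fun s => hl s 0⟩
  -- If every stage meets F, compactness gives a common point in F, and by uniqueness it is l(s).
  have : l ⁻¹' F = ⋂ n, {s | (E n s ∩ F).Nonempty} := by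
    ext s
    simp only [mem_preimage, mem_iInter, mem_ofPred_eq]
    refine ⟨fun h n => ⟨l s, hl s n, h⟩, fun h => ?_⟩
    obtain ⟨a, ha⟩ := hcantor F hF s h
    rw [huniq s (l s) a (hl s) fun n => (mem_iInter.1 ha n).1]
    exact (mem_iInter.1 ha 0).2
  rw [this]
  exact MeasurableSet.iInter fun n => (hE n).2.2 F hF

/-- Measurable maximizers of u.s.c. functions over u.s.c. compact-valued correspondences. -/
theorem exists_measurable_argmax {S A : Type*} [TopologicalSpace S] [MeasurableSpace S]
    [OpensMeasurableSpace S] [MetricSpace A] [TopologicalSpace.SeparableSpace A]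
    [MeasurableSpace A] [BorelSpace A] {Γ : S → Set A} {q : S × A → ℝ}
    (hΓ : UpperHemicontinuous Γ) (hΓc : ∀ s, IsCompact (Γ s)) (hΓn : ∀ s, (Γ s).Nonempty)
    (hq : UpperSemicontinuous q) :
    ∃ l : S → A, Measurable l ∧ ∀ s, l s ∈ argmaxOn Γ q s :=
  exists_measurable_selection
    (fun s => isCompact_argmaxOn (hq.section_right s) (hΓc s))
    (fun s => nonempty_argmaxOn (hq.section_right s) (hΓc s) (hΓn s))
    fun _ hF => measurableSet_argmaxOn_inter_nonempty hq.section_right hΓc hΓn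
      (fun _ hG c => (hΓ.isClosed_setOf_exists_le hΓc hq hG c).measurableSet) hF

end Selection

namespace DiscountedDP

/-! ### Laws of strategies and their expected payoffs -/

section Law

variable {S A : Type*} [MeasurableSpace S] [MeasurableSpace A] {M : DiscountedDP S A}

instance (σ : M.Strategy) (s : S) : IsProbabilityMeasure (σ.law s) := by
  unfold Strategy.law; infer_instance

lemma Strategy.law_map_zero (σ : M.Strategy) (s : S) :
    (σ.law s).map (fun ω => ω 0) = Measure.dirac (s, σ.act 0 (Fin.elim0, s)) := by
  have h : (fun ω : ℕ → S × A => ω 0) =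
      (fun y : Finset.Iic 0 → S × A => y ⟨0, Finset.mem_Iic.2 le_rfl⟩) ∘
        Preorder.frestrictLe (π := fun _ => S × A) 0 := rfl
  rw [h, ← Measure.map_map (measurable_pi_apply _) (by fun_prop), Strategy.law,
    Kernel.trajMeasure, Measure.map_dirac' (MeasurableEquiv.measurable _), Measure.dirac_bind (Kernel.measurable _),
    Kernel.traj_map_frestrictLe_apply, Kernel.partialTraj_self, Kernel.id_apply,
    Measure.map_dirac' (measurable_pi_apply _)]
  rfl

lemma Strategy.law_map_succ (σ : M.Strategy) (s : S) (n : ℕ) :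
    (σ.law s).map (fun ω => (Preorder.frestrictLe (π := fun _ => S × A) n ω, ω (n + 1))) =
      (σ.law s).map (Preorder.frestrictLe (π := fun _ => S × A) n) ⊗ₘ σ.step n :=
  Kernel.map_frestrictLe_trajMeasure_compProd_eq_map_trajMeasure.symm

/-- The state-action pairs stay in every measurable set that the strategy never leaves. -/
lemma Strategy.ae_law_mem (σ : M.Strategy) (s : S) {B : Set (S × A)} (hB : MeasurableSet B)
    (h : ∀ n (x : History S A n), (x.2, σ.act n x) ∈ B) (n : ℕ) :
    ∀ᵐ ω ∂σ.law s, ω n ∈ B := by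
  cases n with
  | zero =>
    have : ∀ᵐ y ∂(σ.law s).map (fun ω => ω 0), y ∈ B := by
      rw [σ.law_map_zero]
      exact (ae_dirac_iff (p := (· ∈ B)) hB).2 (h 0 (Fin.elim0, s))
    exact ae_of_ae_map (measurable_pi_apply _).aemeasurable this
  | succ n =>
    have : ∀ᵐ y ∂(σ.law s).map
        (fun ω => (Preorder.frestrictLe (π := fun _ => S × A) n ω, ω (n + 1))), y.2 ∈ B := by
      rw [σ.law_map_succ]
      refine Measure.ae_compProd_of_ae_ae (measurable_snd hB) (ae_of_all _ fun x => ?_)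
      rw [σ.step_apply]
      refine (ae_map_iff (p := (· ∈ B)) ((σ.measurable_nextPair n).comp measurable_prodMk_left).aemeasurable
        hB).2 (ae_of_all _ fun s' => h (n + 1) (_, s'))
    exact ae_of_ae_map (f := fun ω => (Preorder.frestrictLe (π := fun _ => S × A) n ω, ω (n + 1)))
      (Measurable.aemeasurable (by fun_prop)) this

/-- Given the past, the next state has law `M.p (ω n)`; the action attached by the strategy is
invisible to a function of the state. -/
lemma Strategy.integral_law_succ (σ : M.Strategy) (s : S) (n : ℕ) {f : S → ℝ}
    (hf : Measurable f) {C : ℝ} (hC : ∀ s, |f s| ≤ C) :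
    ∫ ω, f (ω (n + 1)).1 ∂σ.law s = ∫ ω, ∫ s', f s' ∂M.p (ω n) ∂σ.law s := by
  have hm : Measurable fun ω : ℕ → S × A =>
      (Preorder.frestrictLe (π := fun _ => S × A) n ω, ω (n + 1)) := by fun_prop
  have hg : Measurable fun y : (Finset.Iic n → S × A) × (S × A) => f y.2.1 := by fun_prop
  have hpm : IsProbabilityMeasure
      ((σ.law s).map (Preorder.frestrictLe (π := fun _ => S × A) n)) :=
    Measure.isProbabilityMeasure_map (Measurable.aemeasurable (by fun_prop))
  calc ∫ ω, f (ω (n + 1)).1 ∂σ.law s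
      = ∫ y, f y.2.1 ∂(σ.law s).map
          (fun ω => (Preorder.frestrictLe (π := fun _ => S × A) n ω, ω (n + 1))) :=
        (integral_map hm.aemeasurable hg.aestronglyMeasurable).symm
    _ = ∫ x, ∫ y, f y.1 ∂σ.step n x ∂(σ.law s).map
          (Preorder.frestrictLe (π := fun _ => S × A) n) := by
        rw [σ.law_map_succ]
        exact Measure.integral_compProd
          (Integrable.of_bound hg.aestronglyMeasurable C (ae_of_all _ fun y => hC _))
    _ = ∫ x, ∫ s', f s' ∂M.p (x ⟨n, Finset.mem_Iic.2 le_rfl⟩) ∂(σ.law s).map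
          (Preorder.frestrictLe (π := fun _ => S × A) n) := by
        congr with x
        rw [σ.step_apply]
        exact integral_map (f := fun y : S × A => f y.1)
          ((σ.measurable_nextPair n).comp measurable_prodMk_left).aemeasurable
          (hf.comp measurable_fst).aestronglyMeasurable
    _ = ∫ ω, ∫ s', f s' ∂M.p (ω n) ∂σ.law s := by
        have hi : Measurable fun x : Finset.Iic n → S × A =>
            ∫ s', f s' ∂M.p (x ⟨n, Finset.mem_Iic.2 le_rfl⟩) :=
          (hf.stronglyMeasurable.integral_kernel (κ := M.p)).measurable.comp
            (measurable_pi_apply _)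
        rw [integral_map (Measurable.aemeasurable (by fun_prop)) hi.aestronglyMeasurable]
        rfl

lemma summable_discounted {u : ℕ → ℝ} {C : ℝ} (hu : ∀ n, |u n| ≤ C) :
    Summable fun n => M.β ^ n * u n := by
  refine Summable.of_norm_bounded
    ((summable_geometric_of_lt_one M.β_pos.le M.β_lt_one).mul_right C) fun n => ?_
  rw [Real.norm_eq_abs, abs_mul, abs_pow, abs_of_pos M.β_pos]
  exact mul_le_mul_of_nonneg_left (hu n) (pow_nonneg M.β_pos.le n)

lemma integrable_comp_eval (σ : M.Strategy) (s : S) {g : S × A → ℝ} (hg : Measurable g) {C : ℝ}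
    (hC : ∀ x, |g x| ≤ C) (n : ℕ) : Integrable (fun ω : ℕ → S × A => g (ω n)) (σ.law s) :=
  Integrable.of_bound (hg.comp (measurable_pi_apply n)).aestronglyMeasurable C
    (ae_of_all _ fun _ => hC _)

lemma abs_integral_le {X : Type*} [MeasurableSpace X] {μ : Measure X} [IsProbabilityMeasure μ]
    {g : X → ℝ} {C : ℝ} (hC : ∀ x, |g x| ≤ C) : |∫ x, g x ∂μ| ≤ C := by
  simpa using norm_integral_le_of_norm_le_const (μ := μ) (f := g) (ae_of_all _ hC)

lemma measurable_discountedPayoff : Measurable M.discountedPayoff :=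
  Measurable.tsum fun t =>
    (M.measurable_r.comp (measurable_pi_apply t)).const_mul (M.β ^ t)

lemma integrable_discountedPayoff {C : ℝ} (hC : ∀ x, |M.r x| ≤ C) (σ : M.Strategy) (s : S) :
    Integrable M.discountedPayoff (σ.law s) := by
  refine Integrable.of_bound measurable_discountedPayoff.aestronglyMeasurable
    (∑' n, M.β ^ n * C) (ae_of_all _ fun ω => ?_)
  refine tsum_of_norm_bounded
    ((summable_geometric_of_lt_one M.β_pos.le M.β_lt_one).mul_right C).hasSum fun n => ?_
  rw [Real.norm_eq_abs, abs_mul, abs_pow, abs_of_pos M.β_pos]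
  exact mul_le_mul_of_nonneg_left (hC _) (pow_nonneg M.β_pos.le n)

/-- Boundedness of r allows exchanging sum and expectation, so payoffs can be compared term by term
with `hasSum_telescope`. -/
lemma hasSum_expectedPayoff {C : ℝ} (hC : ∀ x, |M.r x| ≤ C) (σ : M.Strategy) (s : S) :
    HasSum (fun n => M.β ^ n * ∫ ω, M.r (ω n) ∂σ.law s) (M.expectedPayoff σ s) := by
  have h := hasSum_integral_of_summable_integral_norm
    (μ := σ.law s) (F := fun (n : ℕ) (ω : ℕ → S × A) => M.β ^ n * M.r (ω n))
    (fun n => (integrable_comp_eval σ s M.measurable_r hC n).const_mul _) (by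
      simp_rw [norm_mul, integral_const_mul, norm_pow, Real.norm_eq_abs, abs_of_pos M.β_pos]
      exact summable_discounted fun n => abs_integral_le fun ω => by simpa using hC _)
  simp only [integral_const_mul] at h
  exact h

lemma hasSum_telescope {u : ℕ → ℝ} {C : ℝ} (hu : ∀ n, |u n| ≤ C) :
    HasSum (fun n => M.β ^ n * (u n - M.β * u (n + 1))) (u 0) := by
  have h := (summable_discounted (M := M) hu).hasSum
  have h' := h.sub ((hasSum_nat_add_iff' 1).2 h)
  simp only [Finset.sum_range_one, pow_zero, one_mul, sub_sub_cancel] at h'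
  have hfun : (fun n => M.β ^ n * (u n - M.β * u (n + 1))) =
      fun n => M.β ^ n * u n - M.β ^ (n + 1) * u (n + 1) := by
    funext n
    ring
  rw [hfun]
  exact h'

lemma integral_Q (σ : M.Strategy) (s : S) {C C' : ℝ} (hr : ∀ x, |M.r x| ≤ C) {f : S → ℝ}
    (hf : Measurable f) (hC : ∀ s, |f s| ≤ C') (n : ℕ) :
    Integrable (fun ω : ℕ → S × A => M.Q (ω n).1 (ω n).2 f) (σ.law s) ∧
    ∫ ω, M.Q (ω n).1 (ω n).2 f ∂σ.law s =
      ∫ ω, M.r (ω n) ∂σ.law s + M.β * ∫ ω, f (ω (n + 1)).1 ∂σ.law s := by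
  have h1 := integrable_comp_eval σ s M.measurable_r hr n
  have h2 := (integrable_comp_eval σ s
    (hf.stronglyMeasurable.integral_kernel (κ := M.p)).measurable
    (fun x => abs_integral_le hC) n).const_mul M.β
  refine ⟨h1.add h2, ?_⟩
  rw [σ.integral_law_succ s n hf hC, ← integral_const_mul, ← integral_add h1 h2]
  rfl

lemma measurable_Q {f : S → ℝ} (hf : Measurable f) :
    Measurable fun x : S × A => M.Q x.1 x.2 f :=
  M.measurable_r.add
    ((hf.stronglyMeasurable.integral_kernel (κ := M.p)).measurable.const_mul M.β)

lemma integral_state_zero (σ : M.Strategy) (s : S) {f : S → ℝ} (hf : Measurable f) :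
    ∫ ω, f (ω 0).1 ∂σ.law s = f s := by
  have h := integral_map (μ := σ.law s) (φ := fun ω : ℕ → S × A => ω 0)
    (f := fun x : S × A => f x.1) (measurable_pi_apply 0).aemeasurable
    (hf.comp measurable_fst).aestronglyMeasurable
  rw [← h, σ.law_map_zero]
  exact integral_dirac' _ _ (hf.comp measurable_fst).stronglyMeasurable

/-- A bounded measurable function that dominates its one-step payoffs dominates the payoffs of
all strategies. -/
lemma expectedPayoff_le {C C' : ℝ} (hr : ∀ x, |M.r x| ≤ C) {f : S → ℝ} (hf : Measurable f)
    (hC : ∀ s, |f s| ≤ C') (hle : ∀ s, ∀ a ∈ M.Γ s, M.Q s a f ≤ f s) (σ : M.Strategy) (s : S) :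
    M.expectedPayoff σ s ≤ f s := by
  have h := hasSum_telescope (M := M) (u := fun n => ∫ ω, f (ω n).1 ∂σ.law s)
    (fun n => abs_integral_le fun ω => hC _)
  rw [integral_state_zero σ s hf] at h
  refine hasSum_le (fun n => ?_) (hasSum_expectedPayoff hr σ s) h
  refine mul_le_mul_of_nonneg_left ?_ (pow_nonneg M.β_pos.le n)
  obtain ⟨hi, he⟩ := integral_Q σ s hr hf hC n
  rw [le_sub_iff_add_le, ← he]
  refine integral_mono_ae hi
    (integrable_comp_eval σ s (hf.comp measurable_fst) (fun x => hC x.1) n) ?_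
  -- Using this set, measurable because Q and f are, avoids any measurability of the graph of Γ.
  exact σ.ae_law_mem s (B := {x | M.Q x.1 x.2 f ≤ f x.1})
    (measurableSet_le (measurable_Q hf) (hf.comp measurable_fst))
    (fun n x => hle _ _ (σ.feasible n x)) n

lemma expectedPayoff_stationary {C C' : ℝ} (hr : ∀ x, |M.r x| ≤ C) {f : S → ℝ}
    (hf : Measurable f) (hC : ∀ s, |f s| ≤ C') {l : S → A} (hl : Measurable l)
    (hl' : ∀ s, l s ∈ M.Γ s) (heq : ∀ s, M.Q s (l s) f = f s) (s : S) :
    M.expectedPayoff (Strategy.stationary l hl hl') s = f s := by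
  set σ := Strategy.stationary l hl hl'
  have h := hasSum_telescope (M := M) (u := fun n => ∫ ω, f (ω n).1 ∂σ.law s)
    (fun n => abs_integral_le fun ω => hC _)
  rw [integral_state_zero σ s hf] at h
  refine (hasSum_expectedPayoff hr σ s).unique ?_
  convert h using 3 with n
  obtain ⟨hi, he⟩ := integral_Q σ s hr hf hC n
  rw [eq_sub_iff_add_eq, ← he]
  refine integral_congr_ae ?_
  exact σ.ae_law_mem s (B := {x | M.Q x.1 x.2 f = f x.1})
    (measurableSet_eq_fun (measurable_Q hf) (hf.comp measurable_fst))
    (fun n x => heq _) n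

end Law

/-! ### The Bellman operator and its fixed point -/

/-- Uniform limits of bounded u.s.c. functions are bounded and u.s.c. -/
lemma IsBddUSC.of_uniform_limit {S : Type*} [TopologicalSpace S] {v : ℕ → S → ℝ} {f : S → ℝ} {ε : ℕ → ℝ}
    (hv : ∀ n, IsBddUSC (v n)) (hε : Tendsto ε atTop (𝓝 0)) (h : ∀ n s, |v n s - f s| ≤ ε n) :
    IsBddUSC f := by
  constructor
  · obtain ⟨C, hC⟩ := (hv 0).1
    refine ⟨C + ε 0, fun s => ?_⟩
    have h1 := abs_le.1 (h 0 s)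
    have h2 := abs_le.1 (hC s)
    rw [abs_le]
    constructor <;> linarith
  · intro s y hy
    -- Half the gap pays for passing from f to v n at s and back at s'.
    obtain ⟨n, hn⟩ := (hε.eventually_lt_const (show 0 < (y - f s) / 2 by linarith)).exists
    have h1 := abs_le.1 (h n s)
    filter_upwards [(hv n).2 s (y - ε n) (by linarith)] with s' hs'
    have h2 := abs_le.1 (h n s')
    linarith

section Bellman

variable {S A : Type*} [TopologicalSpace S] [MeasurableSpace S] [TopologicalSpace A]
  [MeasurableSpace A] {M : DiscountedDP S A}

lemma isBddUSC_Q (hr : IsBddUSC M.r) (hp : KernelUSC M.p) {f : S → ℝ} (hf : IsBddUSC f) :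
    IsBddUSC fun x : S × A => M.Q x.1 x.2 f := by
  obtain ⟨⟨C, hC⟩, hru⟩ := hr
  obtain ⟨⟨C', hC'⟩, hu⟩ := hp f hf
  refine ⟨⟨C + M.β * C', fun x => (abs_add_le _ _).trans (add_le_add (hC x) ?_)⟩, hru.add ?_⟩
  · rw [abs_mul, abs_of_pos M.β_pos]
    exact mul_le_mul_of_nonneg_left (hC' x) M.β_pos.le
  · exact (continuous_const_mul M.β).comp_upperSemicontinuous hu
      (monotone_mul_left_of_nonneg M.β_pos.le)

lemma exists_bellman_eq (hr : IsBddUSC M.r) (hp : KernelUSC M.p)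
    (hΓn : ∀ s, (M.Γ s).Nonempty) (hΓc : ∀ s, IsCompact (M.Γ s)) {f : S → ℝ} (hf : IsBddUSC f)
    (s : S) : ∃ a ∈ M.Γ s, (∀ b ∈ M.Γ s, M.Q s b f ≤ M.Q s a f) ∧ M.bellman f s = M.Q s a f :=
  (isBddUSC_Q hr hp hf).2.exists_isGreatest_image hΓc hΓn s

lemma isBddUSC_bellman (hr : IsBddUSC M.r) (hp : KernelUSC M.p) (hΓ : UpperHemicontinuous M.Γ)
    (hΓn : ∀ s, (M.Γ s).Nonempty) (hΓc : ∀ s, IsCompact (M.Γ s)) {f : S → ℝ} (hf : IsBddUSC f) :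
    IsBddUSC (M.bellman f) := by
  obtain ⟨⟨C, hC⟩, hu⟩ := isBddUSC_Q hr hp hf
  refine ⟨⟨C, fun s => ?_⟩, hΓ.upperSemicontinuous_iSup hΓc hΓn hu⟩
  obtain ⟨a, -, -, h⟩ := exists_bellman_eq hr hp hΓn hΓc hf s
  rw [h]
  exact hC (s, a)

lemma IsBddUSC.integrable [OpensMeasurableSpace S] {f : S → ℝ} (hf : IsBddUSC f)
    (μ : Measure S) [IsFiniteMeasure μ] : Integrable f μ := by
  obtain ⟨⟨C, hC⟩, hu⟩ := hf
  exact Integrable.of_bound hu.measurable.aestronglyMeasurable C (ae_of_all _ hC)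

/-- A maximizer for f is a feasible competitor for g, and the constant δ passes through the
probability `M.p (s, a)` unchanged before being multiplied by β. -/
lemma bellman_le_add [OpensMeasurableSpace S] (hr : IsBddUSC M.r) (hp : KernelUSC M.p)
    (hΓn : ∀ s, (M.Γ s).Nonempty) (hΓc : ∀ s, IsCompact (M.Γ s)) {f g : S → ℝ}
    (hf : IsBddUSC f) (hg : IsBddUSC g) {δ : ℝ} (h : ∀ s, f s ≤ g s + δ) (s : S) :
    M.bellman f s ≤ M.bellman g s + M.β * δ := by
  obtain ⟨a, ha, -, hfa⟩ := exists_bellman_eq hr hp hΓn hΓc hf s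
  obtain ⟨b, -, hmax, hgb⟩ := exists_bellman_eq hr hp hΓn hΓc hg s
  have hint : ∫ s', f s' ∂M.p (s, a) ≤ ∫ s', g s' ∂M.p (s, a) + δ := by
    have := integral_mono (hf.integrable (M.p (s, a)))
      ((hg.integrable (M.p (s, a))).add (integrable_const δ)) h
    rwa [integral_add' (hg.integrable _) (integrable_const δ), integral_const, probReal_univ,
      one_smul] at this
  rw [hfa, hgb]
  refine le_trans ?_ (add_le_add_left (hmax a ha) _)
  have := mul_le_mul_of_nonneg_left hint M.β_pos.le
  simp only [Q]
  linarith

/-- The Bellman operator is a contraction in the supremum norm. -/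
lemma abs_bellman_sub_le [OpensMeasurableSpace S] (hr : IsBddUSC M.r) (hp : KernelUSC M.p)
    (hΓn : ∀ s, (M.Γ s).Nonempty) (hΓc : ∀ s, IsCompact (M.Γ s)) {f g : S → ℝ}
    (hf : IsBddUSC f) (hg : IsBddUSC g) {δ : ℝ} (h : ∀ s, |f s - g s| ≤ δ) (s : S) :
    |M.bellman f s - M.bellman g s| ≤ M.β * δ := by
  have h1 := bellman_le_add hr hp hΓn hΓc hf hg
    (fun s => by linarith [(abs_le.1 (h s)).2]) s
  have h2 := bellman_le_add hr hp hΓn hΓc hg hf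
    (fun s => by linarith [(abs_le.1 (h s)).1]) s
  rw [abs_le]
  constructor <;> linarith

/-- The Bellman equation has a bounded u.s.c. solution. -/
theorem exists_bellman_fixedPoint [OpensMeasurableSpace S] (hr : IsBddUSC M.r) (hp : KernelUSC M.p)
    (hΓ : UpperHemicontinuous M.Γ) (hΓn : ∀ s, (M.Γ s).Nonempty)
    (hΓc : ∀ s, IsCompact (M.Γ s)) : ∃ f : S → ℝ, IsBddUSC f ∧ M.bellman f = f := by
  let v : ℕ → S → ℝ := fun n => M.bellman^[n] 0
  have hvs : ∀ n, v (n + 1) = M.bellman (v n) := fun n => Function.iterate_succ_apply' _ _ _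
  have hv : ∀ n, IsBddUSC (v n) := by
    intro n
    induction n with
    | zero => exact ⟨⟨0, fun s => by simp [v]⟩, upperSemicontinuous_const⟩
    | succ n ih => rw [hvs]; exact isBddUSC_bellman hr hp hΓ hΓn hΓc ih
  -- Since v 0 = 0, a bound on v 1 bounds the first step of the iteration.
  obtain ⟨K, hK⟩ := (hv 1).1
  have hstep : ∀ n s, |v n s - v (n + 1) s| ≤ K * M.β ^ n := by
    intro n
    induction n with
    | zero => intro s; simpa [v] using hK s
    | succ n ih =>
      intro s
      have := abs_bellman_sub_le hr hp hΓn hΓc (hv n) (hv (n + 1)) ih s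
      rw [← hvs, ← hvs] at this
      exact this.trans_eq (by ring)
  have hlim : ∀ s, ∃ y, Tendsto (fun n => v n s) atTop (𝓝 y) := fun s =>
    cauchySeq_tendsto_of_complete (cauchySeq_of_le_geometric M.β K M.β_lt_one fun n => hstep n s)
  choose f hf using hlim
  have hdist : ∀ n s, |v n s - f s| ≤ K * M.β ^ n / (1 - M.β) := fun n s =>
    dist_le_of_le_geometric_of_tendsto M.β K M.β_lt_one (fun n => hstep n s) (hf s) n
  have hε : Tendsto (fun n => K * M.β ^ n / (1 - M.β)) atTop (𝓝 0) := by
    simpa using ((tendsto_pow_atTop_nhds_zero_of_lt_one M.β_pos.le M.β_lt_one).const_mul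
      K).div_const (1 - M.β)
  have hfu : IsBddUSC f := IsBddUSC.of_uniform_limit hv hε hdist
  -- The shifted iterates v (n + 1) tend both to f and, by contraction, to `M.bellman f`.
  refine ⟨f, hfu, funext fun s => tendsto_nhds_unique ?_ ((tendsto_add_atTop_iff_nat 1).2 (hf s))⟩
  rw [tendsto_iff_dist_tendsto_zero]
  refine squeeze_zero (fun _ => dist_nonneg) (fun n => ?_) (by simpa using hε.const_mul M.β)
  rw [hvs]
  exact abs_bellman_sub_le hr hp hΓn hΓc (hv n) hfu (hdist n) s

end Bellman

/-! ### Verification and the main theorem -/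

/-- A bounded u.s.c. solution of the Bellman equation is the value function, and a measurable
selection of maximizers is optimal. -/
theorem exists_optimal_of_bellman_eq {S A : Type*} [TopologicalSpace S] [MeasurableSpace S]
    [OpensMeasurableSpace S] [MetricSpace A] [TopologicalSpace.SeparableSpace A]
    [MeasurableSpace A] [BorelSpace A] {M : DiscountedDP S A} (hr : IsBddUSC M.r)
    (hp : KernelUSC M.p) (hΓ : UpperHemicontinuous M.Γ) (hΓn : ∀ s, (M.Γ s).Nonempty)
    (hΓc : ∀ s, IsCompact (M.Γ s)) {f : S → ℝ} (hf : IsBddUSC f) (hfix : M.bellman f = f) :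
    f = M.value ∧
    (∀ s, IsLUB (range fun σ : M.Strategy => M.expectedPayoff σ s) (f s)) ∧
    ∃ (l : S → A) (hl : Measurable l) (hl' : ∀ s, l s ∈ M.Γ s),
      M.IsOptimal (Strategy.stationary l hl hl') := by
  obtain ⟨C, hC⟩ := hr.1
  obtain ⟨C', hC'⟩ := hf.1
  have hfm : Measurable f := hf.2.measurable
  obtain ⟨l, hl, hmax⟩ := exists_measurable_argmax hΓ hΓc hΓn (isBddUSC_Q hr hp hf).2
  have hQ : ∀ s, M.Q s (l s) f = f s ∧ ∀ a ∈ M.Γ s, M.Q s a f ≤ f s := by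
    intro s
    obtain ⟨a, ha, hle, heq⟩ := exists_bellman_eq hr hp hΓn hΓc hf s
    rw [hfix] at heq
    rw [heq]
    exact ⟨le_antisymm (hle _ (hmax s).1) ((hmax s).2 a ha), hle⟩
  have hle : ∀ σ s, M.expectedPayoff σ s ≤ f s :=
    expectedPayoff_le hC hfm hC' fun s => (hQ s).2
  have heq : ∀ s, M.expectedPayoff (Strategy.stationary l hl fun s => (hmax s).1) s = f s :=
    expectedPayoff_stationary hC hfm hC' hl _ fun s => (hQ s).1
  have hlub : ∀ s, IsGreatest (range fun σ : M.Strategy => M.expectedPayoff σ s) (f s) :=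
    fun s => ⟨⟨_, heq s⟩, by rintro _ ⟨σ, rfl⟩; exact hle σ s⟩
  have hval : f = M.value := funext fun s => (hlub s).csSup_eq.symm
  exact ⟨hval, fun s => (hlub s).isLUB, l, hl, fun s => (hmax s).1, fun s => by rw [heq, hval]⟩

end DiscountedDP

theorem mainTheorem2 {S : Type*} [MetricSpace S] [CompleteSpace S]
    [TopologicalSpace.SeparableSpace S] [MeasurableSpace S] [BorelSpace S]
    {k : ℕ} (A : Set (EuclideanSpace ℝ (Fin k))) (hA : MeasurableSet A)
    (M : DiscountedDP S A)
    (hr : DiscountedDP.IsBddUSC M.r)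
    (hp : DiscountedDP.KernelUSC M.p)
    (hΓ : UpperHemicontinuous M.Γ)
    (hΓ_nonempty : ∀ s, (M.Γ s).Nonempty)
    (hΓ_compact : ∀ s, IsCompact (M.Γ s)) :
    -- the expected payoffs exist and the supremum that defines `V` is a genuine one
    (∀ (σ : M.Strategy) (s : S),
        (∀ ω : ℕ → S × A, Summable fun t : ℕ => M.β ^ t * M.r (ω t)) ∧
        Integrable M.discountedPayoff (σ.law s)) ∧
    (∀ s, IsLUB (Set.range fun σ : M.Strategy => M.expectedPayoff σ s) (M.value s)) ∧
    -- `V` is the unique bounded u.s.c. solution of the Bellman equation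
    (DiscountedDP.IsBddUSC M.value ∧ M.bellman M.value = M.value ∧
      ∀ f : S → ℝ, DiscountedDP.IsBddUSC f → M.bellman f = f → f = M.value) ∧
    -- there is an optimal Borel measurable stationary policy
    ∃ (l : S → A) (hl : Measurable l) (hf : ∀ s, l s ∈ M.Γ s),
      M.IsOptimal (DiscountedDP.Strategy.stationary l hl hf) := by
  obtain ⟨f, hf, hfix⟩ :=
    DiscountedDP.exists_bellman_fixedPoint hr hp hΓ hΓ_nonempty hΓ_compact
  obtain ⟨rfl, hlub, hopt⟩ :=
    DiscountedDP.exists_optimal_of_bellman_eq hr hp hΓ hΓ_nonempty hΓ_compact hf hfix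
  obtain ⟨C, hC⟩ := hr.1
  exact ⟨fun σ s => ⟨fun ω => DiscountedDP.summable_discounted fun n => hC (ω n),
      DiscountedDP.integrable_discountedPayoff hC σ s⟩, hlub,
    ⟨hf, hfix, fun g hg hgfix =>
      (DiscountedDP.exists_optimal_of_bellman_eq hr hp hΓ hΓ_nonempty hΓ_compact hg hgfix).1⟩,
    hopt⟩
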